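/- Let $p\ge 3$ be a prime and let $T|S$ be a finite and purely (i.e. totally) ramified extension of discrete valuation rings of residue characteristic $p$, with fields of fractions $L|K$. Assume that $L|K$ is galois of degree $p$, and let $\sigma$ generate the galois group $C_p=\mathrm{Gal}(L|K)$, identified with $\mathrm{Aut}_S(T)$ by restriction to $T$. Let $t$ generate the maximal ideal of $T$, let $s:=(-1)^{p+1}\mathrm{N}_{L|K}(t)\in S$, and write $v_t$, $v_s$ for the normalized valuations of $T$ and $S$ (with value $+\infty$ at $0$). Assume that $b:=v_t(\sigma(t)-t)-1\ge 1$, and write $b=p\,\underline b+\overline b$ with $0\le\overline b\le p-1$. Assume that $v_s(p)\ge b-\underline b$. Write maps on the left. Let $T\wr C_p$ be the twisted group ring, consisting of the formal sums $\sum_{\rho\in C_p}y_\rho\,\rho$ with $y_\rho\in T$, with multiplication $(y\rho)(z\tau)=(y\,\rho(z))(\rho\tau)$. Let $\omega:T\wr C_p\to\mathrm{End}_S(T)$ be the $S$-algebra map sending $y\in T$ to multiplication by $y$ and $\rho\in C_p$ to $\rho$, and let $\Xi$ be the image of $\omega$. All modules are left modules; $T$ is a $\Xi$-module by evaluation. Then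 $\omega$ is injective, so that $T\wr C_p\cong\Xi$, and $(t^0,t^1,\dots,t^{p-1})$ is an $S$-linear basis of $T$. For $0\le i\le p-1$ and $j\ge 0$, let $\varepsilon_{i,j}\in\mathrm{End}_S(T)$ be defined on this basis by $\varepsilon_{i,j}(t^l)=\delta_{i,l}\,s^{q}t^{r}$ for $0\le l\le p-1$, where $l+j=pq+r$ with $0\le r\le p-1$. The elements $$a:=s^{\,b-\underline b-1}\,\varepsilon_{\overline b,\,p-\overline b},\qquad c:=s^{\,\underline b}\sum_{i=0}^{p-1}i\,\varepsilon_{i,\overline b}$$ lie in $\Xi$. Let $\alpha,\beta:\Xi\to\Xi$ and $\chi_0:\Xi\to T$ be the $\Xi$-linear maps with $\alpha(1)=a$, $\beta(1)=c$ and $\chi_0(1)=1=t^0$; thus $\alpha$ and $\beta$ are the right multiplications by $a$ and by $c$. Then the following hold. 1. The sequence of $\Xi$-linear maps $$\cdots\xrightarrow{\beta}\Xi\xrightarrow{\alpha}\Xi\xrightarrow{\beta}\Xi\xrightarrow{\alpha}\Xi\xrightarrow{\beta}\cdots,$$ periodic of period $2$, is a complex, and it is acyclic. 2. The image of $\alpha$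 is isomorphic to $T$ as a $\Xi$-module. More precisely, $\chi_0$ is surjective, and there is an injective $\Xi$-linear map $\iota:T\to\Xi$ with $\alpha=\iota\circ\chi_0$. 3. The truncated complex $$\cdots\to\Xi\xrightarrow{\alpha}\Xi\xrightarrow{\beta}\Xi\to 0,$$ with the last $\Xi$ in degree $0$, consists of projective $\Xi$-modules, and $\chi_0$ in degree $0$ defines a quasi-isomorphism from it to $T$ (concentrated in degree $0$); that is, it is a projective resolution of $T$ over $\Xi$. -/

import Mathlib

open CategoryTheory IsLocalRing

noncomputable section

/-- An extension `T | S` of discrete valuation rings with fields of fractions `L | K` is purely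
(i.e. totally) ramified if its ramification index equals the degree `[L : K]`. -/
def IsPurelyRamified (S T K L : Type*) [CommRing S] [IsLocalRing S] [CommRing T] [IsLocalRing T]
    [Algebra S T] [Field K] [Field L] [Algebra K L] : Prop :=
  (maximalIdeal S).map (algebraMap S T) = maximalIdeal T ^ Module.finrank K L

section Wedderburn

variable (S T : Type*) [CommRing S] [CommRing T] [Algebra S T]

/-- The twisted group ring of the group `Aut_S(T)` over `T`: finite formal sums of terms `y ρ`
with `y : T` and `ρ : T ≃ₐ[S] T`, with multiplication `(y ρ) (z τ) = (y ρ(z)) (ρ τ)`.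

Maps are written on the left here and modules are left modules. In the convention where maps are
written on the right, the multiplication reads `(ρ y) (τ z) = (ρ τ) (y^τ z)`; that ring is the
opposite of the present one, so that its right modules are the left modules of the present one. -/
abbrev TwistedGroupRing : Type _ := SkewMonoidAlgebra T (T ≃ₐ[S] T)

/-- The Wedderburn map from the twisted group ring to `End_S(T)`: it sends `y : T` to the
multiplication by `y`, and an automorphism `ρ` to `ρ`, viewed as an `S`-linear map. -/
def wedderburn : TwistedGroupRing S T →ₐ[S] Module.End S T :=
  SkewMonoidAlgebra.liftNCAlgHom (Algebra.lmul S T) (AlgEquiv.toLinearMapHom S T)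
    (by intro x y; ext z; simp)

/-- The image of the Wedderburn map, a subalgebra of `End_S(T)` (with composition as
multiplication); `T` is a left module over it by evaluation. -/
abbrev Xi : Subalgebra S (Module.End S T) := (wedderburn S T).range

end Wedderburn

section Elements

variable {S T : Type*} [CommRing S] [CommRing T] [Algebra S T] {g : ℕ}

/-- The `S`-linear endomorphism `ε_{i,j}` of `T` with respect to an `S`-basis
`B = (t^0, …, t^{g-1})` of `T` and an element `s` of `S`: it sends `t^l`, for `0 ≤ l < g`, to
`δ_{i,l} s^q t^r`, where `l + j = g q + r` with `0 ≤ r < g`. -/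
def epsilon (B : Module.Basis (Fin g) S T) (s : S) (i j : ℕ) : Module.End S T :=
  B.constr S fun l : Fin g =>
    if i = (l : ℕ) then
      s ^ (((l : ℕ) + j) / g) • B ⟨((l : ℕ) + j) % g, Nat.mod_lt _ l.pos⟩
    else 0

/-- `s^{b - q - 1} ε_{r, g - r}`, where `b = g q + r` with `0 ≤ r < g`. (For `b ≥ 1` and `g ≥ 2`
one has `q + 1 ≤ b`, so no subtraction is truncated.) -/
def alphaElt (B : Module.Basis (Fin g) S T) (s : S) (b : ℕ) : Module.End S T :=
  s ^ (b - b / g - 1) • epsilon B s (b % g) (g - b % g)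

/-- `s^q ∑_{0 ≤ i < g} i ε_{i, r}`, where `b = g q + r` with `0 ≤ r < g`. -/
def betaElt (B : Module.Basis (Fin g) S T) (s : S) (b : ℕ) : Module.End S T :=
  s ^ (b / g) • ∑ i ∈ Finset.range g, i • epsilon B s i (b % g)

end Elements

section Complexes

universe v w

/-- The `A`-linear map `A → M` with `1 ↦ m`, as a morphism of `A`-modules. For `M = A` this is the
right multiplication by `m`. -/
abbrev oneTo (A : Type v) [Ring A] {M : Type v} [AddCommGroup M] [Module A M] (m : M) :
    ModuleCat.of A A ⟶ ModuleCat.of A M :=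
  ModuleCat.ofHom (LinearMap.toSpanSingleton A M m)

variable {C : Type*} [Category C] [Limits.HasZeroMorphisms C] {X : C} (f g : X ⟶ X)
  (hfg : f ≫ g = 0) (hgf : g ≫ f = 0)

/-- The complex `⋯ --g--> X --f--> X --g--> X --f--> X --g--> ⋯`, periodic of period `2` and
unbounded in both directions: the differential leaving an even position is `f`, the one leaving an
odd position is `g`. -/
def periodicComplex : CochainComplex C ℤ where
  X _ := X
  d i j := if i + 1 = j then (if Even i then f else g) else 0
  shape i j h := if_neg h
  d_comp_d' i j k hij hjk := by
    obtain rfl : i + 1 = j := hij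
    obtain rfl : i + 1 + 1 = k := hjk
    by_cases h : Even i
    · have h' : ¬ Even (i + 1) := by rwa [Int.even_add_one, not_not]
      rw [if_pos rfl, if_pos rfl, if_pos h, if_neg h', hfg]
    · have h' : Even (i + 1) := by rwa [Int.even_add_one]
      rw [if_pos rfl, if_pos rfl, if_neg h, if_pos h', hgf]

/-- The truncation `⋯ --g--> X --f--> X --g--> X --> 0` of the periodic complex, with the last `X`
in degree `0`: the differential from degree `n` to degree `n - 1` is `g` for `n` odd and `f` for
`n ≥ 2` even. -/
abbrev truncatedComplex : ChainComplex C ℕ :=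
  HomologicalComplex.alternatingConst X hfg hgf
    (fun _ _ => ComplexShape.down_nat_odd_add)

end Complexes

end

/-! ### Homological bookkeeping: from function exactness to acyclicity and quasi-isomorphism. -/

section PeriodicExactness

universe v w

variable {A : Type w} [Ring A] {X Y : ModuleCat.{v} A} {f g : X ⟶ X} {hfg : f ≫ g = 0}
  {hgf : g ≫ f = 0}

/-! Everything reduces to exactness of two pairs, `α` then `β`, and `β` then `χ₀`. The element `a`
takes values in `S · 1`, so `x * a` depends only on `x 1`. This gives `α = ι ∘ χ₀` with `ι y = y a`
injective, hence `ker α = ker χ₀`, and exactness of `β` then `α` follows.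

Membership in `Ξ` is decided by Lagrange interpolation. Extend `f` to the `T`-linear map `T[X] → T`,
`X ^ l ↦ f (t ^ l)`; for `f = ∑ y_ρ ρ` it is `∑ y_ρ ev_{ρ t}`. On `P_ρ = ∏_{τ ≠ ρ} (X - τ t)` it
returns `y_ρ P_ρ(ρ t)`, and `P_ρ(ρ t)` has valuation `(p - 1)(b + 1)`. So `f ∈ Ξ` iff all these
values are divisible by that power of `t` (`mem_Xi_iff_pow_dvd`). The element `a` passes because it
raises valuations enough. The element `c` passes because it approximates the derivation `t ^ (b + 1)
d/dt`, the error being controlled by `s ≡ t ^ p` modulo `t ^ (p + (p - 1) b)`.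

If `x c = 0`, then `x` kills every `t ^ r` with `r ≠ b % p`, and the criterion at `ρ = 1` forces the
remaining value to be a multiple of that of `a`. If `x 1 = 0`, then `x ∈ Ξ (σ - 1)`. In particular
`c = z (σ - 1)`; comparing valuations at `t` shows that `z` is a unit of `Ξ`, so `Ξ c = Ξ (σ - 1)`.
-/

theorem periodicComplex_acyclic (h₁ : Function.Exact f g) (h₂ : Function.Exact g f) :
    (periodicComplex f g hfg hgf).Acyclic := by
  intro i
  rw [HomologicalComplex.exactAt_iff' _ (i - 1) i (i + 1) (by simp) (by simp),
    ShortComplex.ShortExact.moduleCat_exact_iff_function_exact]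
  have hd : (periodicComplex f g hfg hgf).d i (i + 1) = if Even i then f else g := if_pos rfl
  have hd' : (periodicComplex f g hfg hgf).d (i - 1) i = if Even (i - 1) then f else g :=
    if_pos (by ring)
  change Function.Exact ((periodicComplex f g hfg hgf).d (i - 1) i)
    ((periodicComplex f g hfg hgf).d i (i + 1))
  rw [hd, hd']
  by_cases h : Even i
  · have h' : ¬ Even (i - 1) := by grind
    rwa [if_pos h, if_neg h']
  · have h' : Even (i - 1) := by grind
    rwa [if_neg h, if_pos h']

theorem truncatedComplex_d_succ (n : ℕ) :
    (truncatedComplex f g hfg hgf).d (n + 1) n = if Even (n + 1) then f else g := by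
  simp [truncatedComplex]
  rfl

theorem quasiIso_truncatedComplex {χ : X ⟶ Y} (h : (truncatedComplex f g hfg hgf).d 1 0 ≫ χ = 0)
    (h₁ : Function.Exact f g) (h₂ : Function.Exact g f) (h₃ : Function.Exact g χ)
    (hχ : Function.Surjective χ) :
    QuasiIso ((ChainComplex.toSingle₀Equiv (truncatedComplex f g hfg hgf) Y).symm ⟨χ, h⟩) where
  quasiIsoAt m := by
    cases m with
    | zero =>
      rw [ChainComplex.quasiIsoAt₀_iff, ShortComplex.quasiIso_iff_of_zeros' _ rfl rfl rfl]
      constructor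
      · rw [ShortComplex.ShortExact.moduleCat_exact_iff_function_exact]
        simpa [ChainComplex.toSingle₀Equiv] using! h₃
      · rw [ModuleCat.epi_iff_surjective]
        simpa [ChainComplex.toSingle₀Equiv] using! hχ
    | succ m =>
      rw [quasiIsoAt_iff_exactAt' (hL := ChainComplex.exactAt_succ_single_obj ..),
        HomologicalComplex.exactAt_iff' _ (m + 2) (m + 1) m (by simp) (by simp),
        ShortComplex.ShortExact.moduleCat_exact_iff_function_exact]
      change Function.Exact ((truncatedComplex f g hfg hgf).d (m + 2) (m + 1))
        ((truncatedComplex f g hfg hgf).d (m + 1) m)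
      rw [truncatedComplex_d_succ, truncatedComplex_d_succ]
      by_cases hm : Even (m + 1)
      · have h' : ¬ Even (m + 1 + 1) := by grind
        rwa [if_pos hm, if_neg h']
      · have h' : Even (m + 1 + 1) := by grind
        rwa [if_neg hm, if_pos h']

end PeriodicExactness

/-! ### The Wedderburn map and its image -/

section Wedderburn

variable {S T : Type*} [CommRing S] [CommRing T] [Algebra S T]

theorem wedderburn_single (ρ : T ≃ₐ[S] T) (y : T) :
    wedderburn S T (SkewMonoidAlgebra.single ρ y) = Algebra.lmul S T y * ρ.toLinearMap :=
  SkewMonoidAlgebra.liftNC_single _ _ _ _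

theorem wedderburn_apply (f : TwistedGroupRing S T) (x : T) :
    wedderburn S T f x = f.coeff.sum fun ρ y => y * ρ x := by
  induction f using SkewMonoidAlgebra.induction_on with
  | zero => simp
  | single ρ y => simp [wedderburn_single]
  | add f g hf hg =>
    rw [map_add, LinearMap.add_apply, hf, hg, SkewMonoidAlgebra.coeff_add,
      Finsupp.sum_add_index' (by simp) (by intros; ring)]

/-- Dedekind's independence of characters, applied to automorphisms as multiplicative maps `T → T`.
-/
theorem wedderburn_injective [IsDomain T] : Function.Injective (wedderburn S T) := by
  rw [injective_iff_map_eq_zero]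
  intro f hf
  have hli : LinearIndependent T fun ρ : T ≃ₐ[S] T => (ρ : T → T) :=
    (linearIndependent_monoidHom T T).comp
      (fun ρ : T ≃ₐ[S] T => (((ρ : T →ₐ[S] T) : T →+* T) : T →* T)) fun ρ τ h => by
        ext x; exact DFunLike.congr_fun h x
  have := linearIndependent_iff.1 hli f.coeff (by
    ext x
    have := LinearMap.congr_fun hf x
    rw [wedderburn_apply] at this
    simpa [Finsupp.linearCombination_apply, Finsupp.sum, Finset.sum_apply] using this)
  ext ρ
  simp [this]

theorem lmul_mem_Xi (y : T) : Algebra.lmul S T y ∈ Xi S T :=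
  ⟨SkewMonoidAlgebra.single 1 y, (wedderburn_single _ _).trans (by ext; simp)⟩

theorem toLinearMap_mem_Xi (ρ : T ≃ₐ[S] T) : ρ.toLinearMap ∈ Xi S T :=
  ⟨SkewMonoidAlgebra.single ρ 1, (wedderburn_single _ _).trans (by ext; simp)⟩

theorem mem_Xi_iff [Fintype (T ≃ₐ[S] T)] {f : Module.End S T} :
    f ∈ Xi S T ↔ ∃ y : (T ≃ₐ[S] T) → T, ∀ x, f x = ∑ ρ, y ρ * ρ x := by
  constructor
  · rintro ⟨g, rfl⟩
    exact ⟨g.coeff, fun x => (wedderburn_apply g x).trans (Finsupp.sum_fintype _ _ (by simp))⟩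
  · rintro ⟨y, hy⟩
    have : f = ∑ ρ, Algebra.lmul S T (y ρ) * ρ.toLinearMap := by
      ext x; simp [hy]
    rw [this]
    exact sum_mem fun ρ _ => mul_mem (lmul_mem_Xi _) (toLinearMap_mem_Xi _)

end Wedderburn

/-! ### Inverses inside a subalgebra of endomorphisms -/

section InverseInSubalgebra

open Polynomial in
/-- The inverse of an invertible endomorphism of a finite free module lies in every subalgebra
containing the endomorphism. -/
theorem exists_mul_eq_one_of_isUnit_of_mem {R M : Type*} [CommRing R] [AddCommGroup M] [Module R M]
    [Module.Free R M] [Module.Finite R M] (A : Subalgebra R (Module.End R M))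
    {f : Module.End R M} (hf : f ∈ A) (hu : IsUnit f) : ∃ g ∈ A, g * f = 1 := by
  have h0 : IsUnit (f.charpoly.coeff 0) := by
    have := (LinearMap.isUnit_iff_isUnit_det f).1 hu
    rw [LinearMap.det_eq_sign_charpoly_coeff] at this
    exact isUnit_of_mul_isUnit_right this
  obtain ⟨u, hu⟩ := h0
  -- Cayley–Hamilton: the constant coefficient is a unit, so the relation can be solved for the
  -- inverse as a polynomial in `f`.
  have h := f.aeval_self_charpoly
  rw [← divX_mul_X_add f.charpoly, map_add, map_mul, aeval_X, aeval_C, ← hu] at h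
  refine ⟨-((↑u⁻¹ : R) • aeval f f.charpoly.divX), neg_mem (A.smul_mem ?_ _), ?_⟩
  · exact Algebra.adjoin_le (Set.singleton_subset_iff.2 hf) (aeval_mem_adjoin_singleton R f)
  · rw [neg_mul, smul_mul_assoc, eq_neg_of_add_eq_zero_left h, smul_neg, neg_neg,
      Algebra.algebraMap_eq_smul_one, smul_smul, Units.inv_mul, one_smul]

end InverseInSubalgebra

/-! ### Valuations and bases in a totally ramified extension -/

section TotallyRamified

set_option linter.unusedSectionVars false

variable {S T : Type*} [CommRing S] [IsDomain S] [IsDiscreteValuationRing S]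
  [CommRing T] [IsDomain T] [IsDiscreteValuationRing T] [Algebra S T]
  {s : S} {t : T} {p : ℕ}

theorem associated_map_pow (hst : Associated (algebraMap S T s) (t ^ p)) {e : S} {n : ℕ}
    (he : Associated e (s ^ n)) : Associated (algebraMap S T e) (t ^ (p * n)) := by
  rw [pow_mul]
  have := he.map (algebraMap S T)
  rw [map_pow] at this
  exact this.trans (hst.pow_pow)

theorem exists_associated_pow_mul (hs : Irreducible s)
    (hst : Associated (algebraMap S T s) (t ^ p)) {e : S} (he : e ≠ 0) {w : T} {i : ℕ}
    (hw : Associated w (t ^ i)) :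
    ∃ n, Associated e (s ^ n) ∧ Associated (e • w) (t ^ (p * n + i)) := by
  obtain ⟨n, hn⟩ := IsDiscreteValuationRing.associated_pow_irreducible he hs
  exact ⟨n, hn, by rw [Algebra.smul_def, pow_add]; exact (associated_map_pow hst hn).mul_mul hw⟩

theorem Irreducible.pow_dvd_pow_iff_le (ht : Irreducible t) {m n : ℕ} : t ^ m ∣ t ^ n ↔ m ≤ n :=
  pow_dvd_pow_iff ht.ne_zero ht.not_isUnit

theorem pow_dvd_of_pow_dvd_smul (hs : Irreducible s) (ht : Irreducible t)
    (hst : Associated (algebraMap S T s) (t ^ p)) {e : S} {w : T} {i : ℕ} (hi : i < p)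
    (hw : Associated w (t ^ i)) {k : ℕ} (h : t ^ (p * k) ∣ e • w) : s ^ k ∣ e := by
  rcases eq_or_ne e 0 with rfl | he
  · exact dvd_zero _
  obtain ⟨n, hn, hn'⟩ := exists_associated_pow_mul hs hst he hw
  have h1 := ht.pow_dvd_pow_iff_le.1 (h.trans hn'.dvd)
  have : k ≤ n := by
    by_contra! hlt
    have : p * (n + 1) ≤ p * k := Nat.mul_le_mul_left _ hlt
    grind
  exact (pow_dvd_pow s this).trans hn.symm.dvd

/-- Terms with valuations in distinct classes modulo `p` cannot cancel. -/
theorem pow_dvd_smul_of_pow_dvd_sum (hs : Irreducible s) (ht : Irreducible t)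
    (hst : Associated (algebraMap S T s) (t ^ p)) {w : Fin p → T}
    (hw : ∀ i, Associated (w i) (t ^ (i : ℕ))) (e : Fin p → S) (m : ℕ)
    (h : t ^ m ∣ ∑ i, e i • w i) (i : Fin p) : t ^ m ∣ e i • w i := by
  induction m generalizing i with
  | zero => simp
  | succ m ih =>
    have ih := ih ((pow_dvd_pow t m.le_succ).trans h)
    have key (j : Fin p) (hj : (j : ℕ) ≠ m % p) : t ^ (m + 1) ∣ e j • w j := by
      rcases eq_or_ne (e j) 0 with he | he
      · simp [he]
      obtain ⟨n, -, hn⟩ := exists_associated_pow_mul hs hst he (hw j)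
      have h1 := ht.pow_dvd_pow_iff_le.1 ((ih j).trans hn.dvd)
      have h2 : m ≠ p * n + j := by
        rintro rfl
        rw [Nat.mul_add_mod, Nat.mod_eq_of_lt j.2] at hj
        exact hj rfl
      exact (pow_dvd_pow t (by omega)).trans hn.symm.dvd
    -- Only the index congruent to `m` can have a term of valuation exactly `m`; that term is the
    -- whole sum minus terms already known to be divisible.
    by_cases hi : (i : ℕ) = m % p
    · rw [← Finset.add_sum_erase _ _ (Finset.mem_univ i)] at h
      refine (dvd_add_left (Finset.dvd_sum fun j hj => key j ?_)).1 h
      rw [← hi]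
      exact fun h => (Finset.ne_of_mem_erase hj) (Fin.ext h)
    · exact key i hi

theorem linearIndependent_of_associated_pow (hs : Irreducible s) (ht : Irreducible t)
    (hst : Associated (algebraMap S T s) (t ^ p)) {w : Fin p → T}
    (hw : ∀ i, Associated (w i) (t ^ (i : ℕ))) : LinearIndependent S w := by
  rw [Fintype.linearIndependent_iff]
  intro e he i
  by_contra hne
  obtain ⟨n, -, hn⟩ := exists_associated_pow_mul hs hst hne (hw i)
  have := pow_dvd_smul_of_pow_dvd_sum hs ht hst hw e (p * n + i + 1) (by simp [he]) i
  have := ht.pow_dvd_pow_iff_le.1 (this.trans hn.dvd)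
  omega

/-- In a totally ramified extension of degree `p`, elements of valuations `0, …, p - 1` form a
basis. -/
theorem exists_basis_of_associated_pow [Module.Finite S T] (hs : Irreducible s)
    (ht : Irreducible t) (hst : Associated (algebraMap S T s) (t ^ p))
    (hrank : Module.finrank S T = p) {w : Fin p → T}
    (hw : ∀ i, Associated (w i) (t ^ (i : ℕ))) :
    ∃ B : Module.Basis (Fin p) S T, ∀ i, B i = w i := by
  have hli := linearIndependent_of_associated_pow hs ht hst hw
  refine ⟨Module.Basis.mk hli fun x _ => ?_, fun i => Module.Basis.mk_apply _ _ _⟩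
  -- By rank, some nonzero multiple `g 0 • x` lies in the span of `w`. Valuations then show that `g
  -- 0` divides every coefficient, so it can be cancelled.
  have hdep : ¬ LinearIndependent S (Fin.cons x w : Fin (p + 1) → T) := fun h => by
    have := h.fintype_card_le_finrank
    simp [hrank] at this
  rw [Fintype.linearIndependent_iff] at hdep
  push Not at hdep
  obtain ⟨g, hg, hne⟩ := hdep
  rw [Fin.sum_univ_succ] at hg
  simp only [Fin.cons_zero, Fin.cons_succ] at hg
  have hg0 : g 0 ≠ 0 := by
    intro h0
    rw [h0, zero_smul, zero_add] at hg
    have := Fintype.linearIndependent_iff.1 hli _ hg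
    obtain ⟨i, hi⟩ := hne
    cases i using Fin.cases with
    | zero => exact hi h0
    | succ j => exact hi (this j)
  obtain ⟨n, hn⟩ := IsDiscreteValuationRing.associated_pow_irreducible hg0 hs
  have hgx : t ^ (p * n) ∣ g 0 • x := by
    rw [Algebra.smul_def]
    exact (associated_map_pow hst hn).symm.dvd.mul_right _
  rw [eq_neg_of_add_eq_zero_left hg, dvd_neg] at hgx
  have hdvd (i : Fin p) : g 0 ∣ g i.succ :=
    hn.dvd.trans <| pow_dvd_of_pow_dvd_smul hs ht hst i.2 (hw i) <|
      pow_dvd_smul_of_pow_dvd_sum hs ht hst hw _ _ hgx i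
  choose c hc using hdvd
  have hinj : Function.Injective (algebraMap S T) := by
    rw [injective_iff_map_eq_zero]
    intro e he
    by_contra hne
    obtain ⟨n, hn⟩ := IsDiscreteValuationRing.associated_pow_irreducible hne hs
    have := associated_map_pow hst hn
    rw [he] at this
    exact pow_ne_zero _ ht.ne_zero ((associated_zero_iff_eq_zero _).1 this.symm)
  have hx : x = ∑ i, (-c i) • w i := by
    have h0 : algebraMap S T (g 0) ≠ 0 := by
      rwa [Ne, map_eq_zero_iff _ hinj]
    apply mul_left_cancel₀ h0
    rw [← Algebra.smul_def, ← Algebra.smul_def, eq_neg_of_add_eq_zero_left hg, Finset.smul_sum,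
      ← Finset.sum_neg_distrib]
    exact Finset.sum_congr rfl fun i _ => by rw [hc i, smul_smul, mul_neg, neg_smul]
  rw [hx]
  exact sum_mem fun i _ => Submodule.smul_mem _ _ (Submodule.subset_span ⟨i, rfl⟩)

theorem isUnit_of_associated_apply_pow [Module.Finite S T] (hs : Irreducible s)
    (ht : Irreducible t) (hst : Associated (algebraMap S T s) (t ^ p))
    (hrank : Module.finrank S T = p) {f : Module.End S T}
    (hf : ∀ i < p, Associated (f (t ^ i)) (t ^ i)) : IsUnit f := by
  obtain ⟨B, hB⟩ := exists_basis_of_associated_pow hs ht hst hrank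
    (w := fun i : Fin p => t ^ (i : ℕ)) fun i => .refl _
  obtain ⟨B', hB'⟩ := exists_basis_of_associated_pow hs ht hst hrank
    (w := fun i : Fin p => f (t ^ (i : ℕ))) fun i => hf i i.2
  have : f = (B.equiv B' (Equiv.refl _)).toLinearMap :=
    B.ext fun i => by
      rw [LinearEquiv.coe_coe, B.equiv_apply, Equiv.refl_apply, hB, hB']
  rw [this, Module.End.isUnit_iff]
  exact (B.equiv B' (Equiv.refl _)).bijective

theorem associated_pow_of_dvd_of_not_dvd (ht : Irreducible t) {x : T} {n : ℕ} (h : t ^ n ∣ x)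
    (h' : ¬ t ^ (n + 1) ∣ x) : Associated x (t ^ n) := by
  obtain ⟨m, hm⟩ := IsDiscreteValuationRing.associated_pow_irreducible (x := x)
    (fun h0 => h' (by rw [h0]; exact dvd_zero _)) ht
  have h1 := ht.pow_dvd_pow_iff_le.1 (h.trans hm.dvd)
  have h2 : m ≤ n := by
    by_contra! hlt
    exact h' ((pow_dvd_pow t hlt).trans hm.symm.dvd)
  rwa [le_antisymm h1 h2]

theorem Irreducible.dvd_of_not_isUnit (ht : Irreducible t) {x : T} (hx : ¬ IsUnit x) : t ∣ x := by
  rcases eq_or_ne x 0 with rfl | h0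
  · exact dvd_zero _
  obtain ⟨n, hn⟩ := IsDiscreteValuationRing.associated_pow_irreducible h0 ht
  cases n with
  | zero => exact absurd (hn.symm.isUnit (by simp)) hx
  | succ n => exact (dvd_pow_self t n.succ_ne_zero).trans hn.symm.dvd

end TotallyRamified

/-! ### Ramification in prime degree and the interpolation polynomials -/

section CyclicRamified

set_option linter.unusedSectionVars false

open Polynomial

/-- Up to sign, the coefficient is an elementary symmetric function of degree `I.card - l` in
multiples of `t`. -/
theorem pow_dvd_coeff_nodal {R ι : Type*} [CommRing R] [Nontrivial R] {t : R} {v : ι → R}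
    (I : Finset ι) (hv : ∀ i ∈ I, t ∣ v i) (l : ℕ) :
    t ^ (I.card - l) ∣ (Lagrange.nodal I v).coeff l := by
  classical
  induction I using Finset.induction_on generalizing l with
  | empty => simp
  | insert i I hi ih =>
    have ih := ih fun j hj => hv j (Finset.mem_insert_of_mem hj)
    rw [Lagrange.nodal_insert_eq_nodal hi, Finset.card_insert_of_notMem hi, sub_mul, coeff_sub,
      coeff_C_mul]
    have h2 : t ^ (I.card + 1 - l) ∣ v i * (Lagrange.nodal I v).coeff l :=
      (pow_dvd_pow t (by omega : I.card + 1 - l ≤ 1 + (I.card - l))).trans <| by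
        rw [pow_add, pow_one]
        exact mul_dvd_mul (hv i (Finset.mem_insert_self _ _)) (ih l)
    refine dvd_sub ?_ h2
    cases l with
    | zero => simp
    | succ l => rw [coeff_X_mul]; simpa using ih l

variable {S T : Type*} [CommRing S] [IsDomain S] [IsDiscreteValuationRing S]
  [CommRing T] [IsDomain T] [IsDiscreteValuationRing T] [Algebra S T]

/-- A totally ramified Galois extension of prime degree `p` of discrete valuation rings, with
uniformizers `s` and `t`, such that `s` is up to sign the norm of `t`, and with ramification
break `b ≥ 1`. -/
structure IsCyclicRamified [Fintype (T ≃ₐ[S] T)] (s : S) (t : T) (p b : ℕ) : Prop where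
  prime : p.Prime
  irreducible_s : Irreducible s
  irreducible_t : Irreducible t
  finrank_eq : Module.finrank S T = p
  card_eq : Fintype.card (T ≃ₐ[S] T) = p
  isInvariant : Algebra.IsInvariant S T (T ≃ₐ[S] T)
  norm_eq : algebraMap S T s = (-1) ^ (p + 1) * ∏ ρ : T ≃ₐ[S] T, ρ t
  cast_p_mem : ¬ IsUnit (p : S)
  one_le : 1 ≤ b
  associated_sub : ∀ ρ : T ≃ₐ[S] T, ρ ≠ 1 → Associated (ρ t - t) (t ^ (b + 1))

theorem associated_algEquiv_apply {t : T} (ht : Irreducible t) (ρ : T ≃ₐ[S] T) :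
    Associated (ρ t) t :=
  IsDiscreteValuationRing.associated_of_irreducible T
    ((MulEquiv.irreducible_iff (ρ : T ≃* T)).2 ht) ht

theorem pow_dvd_algEquiv_apply {t : T} (ht : Irreducible t) (ρ : T ≃ₐ[S] T) {n : ℕ} {x : T}
    (h : t ^ n ∣ x) : t ^ n ∣ ρ x := by
  obtain ⟨y, rfl⟩ := h
  rw [map_mul, map_pow]
  exact ((associated_algEquiv_apply ht ρ).symm.pow_pow).dvd.mul_right _

theorem associated_of_norm_eq [Fintype (T ≃ₐ[S] T)] {t : T} (ht : Irreducible t) {x : T} {n : ℕ}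
    (hx : x = (-1) ^ n * ∏ ρ : T ≃ₐ[S] T, ρ t) :
    Associated x (t ^ Fintype.card (T ≃ₐ[S] T)) := by
  rw [hx, ← Finset.card_univ, ← Finset.prod_const]
  refine (associated_unit_mul_left _ _ (isUnit_neg_one.pow _)).trans ?_
  exact Associated.prod _ _ _ fun ρ _ => associated_algEquiv_apply ht ρ

theorem pow_dvd_pow_apply_sub {t : T} (ht : Irreducible t) {ρ : T ≃ₐ[S] T} {n : ℕ}
    (hρ : t ^ n ∣ ρ t - t) (k : ℕ) : t ^ n ∣ (ρ ^ k) t - t := by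
  induction k with
  | zero => simp
  | succ k ih =>
    have : (ρ ^ (k + 1)) t - t = (ρ ^ k) (ρ t - t) + ((ρ ^ k) t - t) := by
      rw [pow_succ, AlgEquiv.mul_apply, map_sub]; ring
    rw [this]
    exact dvd_add (pow_dvd_algEquiv_apply ht _ hρ) ih

/-- In a Galois group of prime order, all nontrivial elements have the same ramification number. -/
theorem associated_apply_sub_of_ne_one [Finite (T ≃ₐ[S] T)] {t : T} (ht : Irreducible t)
    (hcard : (Nat.card (T ≃ₐ[S] T)).Prime) {σ : T ≃ₐ[S] T} (hσ : Subgroup.zpowers σ = ⊤) {n : ℕ}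
    (hn : Associated (σ t - t) (t ^ n)) {ρ : T ≃ₐ[S] T} (hρ : ρ ≠ 1) :
    Associated (ρ t - t) (t ^ n) := by
  have := Fact.mk hcard
  obtain ⟨k, hk⟩ := mem_powers_iff_mem_zpowers.2 (hσ ▸ Subgroup.mem_top ρ)
  obtain ⟨j, hj⟩ := mem_powers_iff_mem_zpowers.2 (mem_zpowers_of_prime_card rfl hρ (g' := σ))
  refine associated_pow_of_dvd_of_not_dvd ht ?_ fun hdvd => ?_
  · exact hk ▸ pow_dvd_pow_apply_sub ht hn.symm.dvd k
  · have h1 : t ^ (n + 1) ∣ σ t - t := hj ▸ pow_dvd_pow_apply_sub ht hdvd j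
    have := ht.pow_dvd_pow_iff_le.1 (h1.trans hn.dvd)
    omega

namespace IsCyclicRamified

variable [Fintype (T ≃ₐ[S] T)] {s : S} {t : T} {p b : ℕ} (h : IsCyclicRamified s t p b)

include h

theorem associated_s : Associated (algebraMap S T s) (t ^ p) := by
  rw [← h.card_eq]
  exact associated_of_norm_eq h.irreducible_t h.norm_eq

theorem pow_dvd_sub (ρ : T ≃ₐ[S] T) : t ^ (b + 1) ∣ ρ t - t := by
  by_cases hρ : ρ = 1
  · simp [hρ]
  · exact (h.associated_sub ρ hρ).symm.dvd

theorem associated_apply_sub_apply (ρ τ : T ≃ₐ[S] T) (hρ : ρ ≠ τ) : Associated (ρ t - τ t) (t ^ (b + 1)) := by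
  have h1 := (h.associated_sub (τ⁻¹ * ρ) (by rwa [Ne, inv_mul_eq_one, eq_comm])).map τ
  have h2 : τ ((τ⁻¹ * ρ) t - t) = ρ t - τ t := by
    rw [map_sub, ← AlgEquiv.mul_apply, mul_inv_cancel_left]
  rw [h2, map_pow] at h1
  exact h1.trans (associated_algEquiv_apply h.irreducible_t τ).pow_pow

theorem injective_apply : Function.Injective fun ρ : T ≃ₐ[S] T => ρ t := by
  intro ρ τ hρ
  by_contra hne
  have := h.associated_apply_sub_apply ρ τ hne
  rw [show ρ t - τ t = 0 from sub_eq_zero.2 hρ] at this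
  exact pow_ne_zero _ h.irreducible_t.ne_zero ((associated_zero_iff_eq_zero _).1 this.symm)

theorem exists_basis [Module.Finite S T] :
    ∃ B : Module.Basis (Fin p) S T, ∀ i, B i = t ^ (i : ℕ) :=
  exists_basis_of_associated_pow h.irreducible_s h.irreducible_t h.associated_s h.finrank_eq
    fun _ => .refl _

theorem pow_dvd_apply_sub [Module.Finite S T] (ρ : T ≃ₐ[S] T) (x : T) :
    t ^ (b + 1) ∣ ρ x - x := by
  obtain ⟨B, hB⟩ := h.exists_basis
  rw [← B.sum_repr x, map_sum, ← Finset.sum_sub_distrib]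
  refine Finset.dvd_sum fun i _ => ?_
  rw [map_smul, ← smul_sub, hB, map_pow, Algebra.smul_def]
  exact ((h.pow_dvd_sub ρ).trans (sub_dvd_pow_sub_pow _ _ _)).mul_left _

/-- Automorphisms act trivially on the associated graded ring. -/
theorem pow_succ_dvd_apply_sub [Module.Finite S T] (ρ : T ≃ₐ[S] T) {n : ℕ} {x : T}
    (hx : t ^ n ∣ x) : t ^ (n + 1) ∣ ρ x - x := by
  obtain ⟨y, rfl⟩ := hx
  have h1 : ρ (t ^ n * y) - t ^ n * y = (ρ t) ^ n * (ρ y - y) + ((ρ t) ^ n - t ^ n) * y := by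
    rw [map_mul, map_pow]; ring
  have hb := h.one_le
  rw [h1]
  refine dvd_add ?_ (Dvd.dvd.mul_right ?_ _)
  · rw [pow_add]
    refine mul_dvd_mul ((associated_algEquiv_apply h.irreducible_t ρ).symm.pow_pow).dvd ?_
    exact (pow_dvd_pow t (by omega)).trans (h.pow_dvd_apply_sub ρ y)
  · obtain ⟨w, hw⟩ := h.pow_dvd_sub ρ
    have h2 : ρ t = t * (1 + t * (t ^ (b - 1) * w)) := by
      obtain ⟨c, rfl⟩ := Nat.exists_eq_add_of_le hb
      rw [← sub_add_cancel (ρ t) t, hw, Nat.add_sub_cancel_left]; ring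
    have h3 : (ρ t) ^ n - t ^ n = t ^ n * ((1 + t * (t ^ (b - 1) * w)) ^ n - 1 ^ n) := by
      rw [h2, mul_pow]; ring
    rw [h3, pow_succ]
    exact mul_dvd_mul_left _ (Dvd.dvd.trans ⟨t ^ (b - 1) * w, by ring⟩ (sub_dvd_pow_sub_pow _ _ _))

/-- The product of `X - τ(t)` over all `τ ≠ ρ`. -/
noncomputable def _root_.conjNodal [DecidableEq (T ≃ₐ[S] T)] (t : T) (ρ : T ≃ₐ[S] T) : T[X] :=
  Lagrange.nodal (Finset.univ.erase ρ) fun τ : T ≃ₐ[S] T => τ t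

variable [DecidableEq (T ≃ₐ[S] T)]

theorem card_erase (ρ : T ≃ₐ[S] T) : (Finset.univ.erase ρ).card = p - 1 := by
  rw [Finset.card_erase_of_mem (Finset.mem_univ _), Finset.card_univ, h.card_eq]

theorem natDegree_conjNodal (ρ : T ≃ₐ[S] T) : (conjNodal t ρ).natDegree = p - 1 := by
  rw [conjNodal, Lagrange.natDegree_nodal, h.card_erase]

theorem natDegree_conjNodal_lt (ρ : T ≃ₐ[S] T) : (conjNodal t ρ).natDegree < p := by
  rw [h.natDegree_conjNodal]
  exact Nat.sub_one_lt h.prime.ne_zero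

theorem dvd_apply (ρ : T ≃ₐ[S] T) : t ∣ ρ t := (associated_algEquiv_apply h.irreducible_t ρ).symm.dvd

theorem pow_dvd_coeff_conjNodal (ρ : T ≃ₐ[S] T) (l : ℕ) :
    t ^ (p - 1 - l) ∣ (conjNodal t ρ).coeff l := by
  rw [← h.card_erase ρ]
  exact pow_dvd_coeff_nodal _ (fun τ _ => h.dvd_apply τ) l

/-- These are the Lagrange denominators: products of `p - 1` differences of conjugates, each of
valuation `b + 1`. -/
theorem eval_conjNodal_self (ρ : T ≃ₐ[S] T) :
    Associated ((conjNodal t ρ).eval (ρ t)) (t ^ ((p - 1) * (b + 1))) := by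
  rw [conjNodal, Lagrange.eval_nodal, mul_comm, pow_mul, ← h.card_erase ρ, ← Finset.prod_const]
  exact Associated.prod _ _ _ fun τ hτ => h.associated_apply_sub_apply ρ τ (Finset.ne_of_mem_erase hτ).symm

omit h in
theorem _root_.eval_conjNodal_of_ne (t : T) {ρ τ : T ≃ₐ[S] T} (hτ : τ ≠ ρ) :
    (conjNodal t ρ).eval (τ t) = 0 :=
  Lagrange.eval_nodal_at_node (v := fun τ : T ≃ₐ[S] T => τ t)
    (Finset.mem_erase.2 ⟨hτ, Finset.mem_univ _⟩)

theorem pow_dvd_eval_derivative_conjNodal (ρ : T ≃ₐ[S] T) :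
    t ^ ((p - 2) * (b + 1)) ∣ (derivative (conjNodal t ρ)).eval t := by
  rw [conjNodal, Lagrange.derivative_nodal, eval_finsetSum]
  refine Finset.dvd_sum fun τ hτ => ?_
  rw [Lagrange.eval_nodal]
  have : (t ^ (b + 1)) ^ ((Finset.univ.erase ρ).erase τ).card ∣
      ∏ i ∈ (Finset.univ.erase ρ).erase τ, (t - i t) := by
    rw [← Finset.prod_const]
    exact Finset.prod_dvd_prod_of_dvd _ _ fun i _ => (dvd_sub_comm).1 (h.pow_dvd_sub i)
  rwa [Finset.card_erase_of_mem hτ, h.card_erase, ← pow_mul, mul_comm, Nat.sub_sub] at this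

/-- The coefficients of the characteristic polynomial of `t` lie in `S`. -/
theorem exists_coeff : ∃ e : ℕ → S, ∀ l,
    algebraMap S T (e l) =
      (Lagrange.nodal Finset.univ fun τ : T ≃ₐ[S] T => τ t).coeff l := by
  have := h.isInvariant
  have h1 := Algebra.IsInvariant.charpoly_mem_lifts S T (T ≃ₐ[S] T) t
  rw [lifts_iff_coeff_lifts] at h1
  choose e he using h1
  exact ⟨e, he⟩

/-- The sign `(-1) ^ (p + 1)` in `s` serves to make this constant term `-s`, whence `s` is close to
`t ^ p` rather than to `-t ^ p`. -/
theorem coeff_zero : (Lagrange.nodal Finset.univ fun τ : T ≃ₐ[S] T => τ t).coeff 0 =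
    - algebraMap S T s := by
  rw [coeff_zero_eq_eval_zero, Lagrange.eval_nodal, h.norm_eq]
  simp only [zero_sub, Finset.prod_neg, Finset.card_univ, h.card_eq]
  ring

theorem isUnit_cast {i : ℕ} (hi : 0 < i) (hip : i < p) : IsUnit (i : S) := by
  have hc : Nat.Coprime i p := (Nat.coprime_of_lt_prime hi.ne' hip h.prime).symm
  have hc : IsCoprime (i : S) (p : S) := by
    simpa using (Nat.isCoprime_iff_coprime.2 hc).map (Int.castRingHom S)
  obtain ⟨u, v, huv⟩ := hc
  rcases IsLocalRing.isUnit_or_isUnit_of_add_one huv with h1 | h1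
  · exact isUnit_of_mul_isUnit_right h1
  · exact absurd (isUnit_of_mul_isUnit_right h1) h.cast_p_mem

end IsCyclicRamified

end CyclicRamified

/-! ### Comparing `s` with `t ^ p` -/

section CyclicRamified

set_option linter.unusedSectionVars false

open Polynomial

variable {S T : Type*} [CommRing S] [IsDomain S] [IsDiscreteValuationRing S]
  [CommRing T] [IsDomain T] [IsDiscreteValuationRing T] [Algebra S T]

namespace IsCyclicRamified

variable [Fintype (T ≃ₐ[S] T)] {s : S} {t : T} {p b : ℕ} (h : IsCyclicRamified s t p b)

include h

/-- The uniformizer `s` is close to `t ^ p`. -/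
theorem pow_dvd_s_sub_pow : t ^ (p + (p - 1) * b) ∣ algebraMap S T s - t ^ p := by
  classical
  obtain ⟨e, he⟩ := h.exists_coeff
  set N := Lagrange.nodal Finset.univ fun τ : T ≃ₐ[S] T => τ t with hN
  have hp := h.prime.one_lt
  have hdeg : N.natDegree = p := by
    rw [hN, Lagrange.natDegree_nodal, Finset.card_univ, h.card_eq]
  have hlead : N.coeff p = 1 := by
    rw [← hdeg]; exact Lagrange.nodal_monic
  have hder : Associated ((derivative N).eval t) (t ^ ((p - 1) * (b + 1))) := by
    have := Lagrange.eval_nodal_derivative_eval_node_eq (v := fun τ : T ≃ₐ[S] T => τ t)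
      (Finset.mem_univ (1 : T ≃ₐ[S] T))
    rw [← hN] at this
    exact this ▸ h.eval_conjNodal_self 1
  have hsum : (derivative N).eval t = ∑ i : Fin p, (((i : ℕ) + 1 : S) * e (i + 1)) • t ^ (i : ℕ) := by
    rw [eval_eq_sum_range' (n := p) ((natDegree_derivative_lt (by omega)).trans_eq hdeg),
      Finset.sum_range]
    refine Finset.sum_congr rfl fun i _ => ?_
    rw [coeff_derivative, Algebra.smul_def, map_mul, he, map_add, map_natCast, map_one]
    ring
  -- The terms of `N'(t)` have distinct valuations modulo `p`, so each inherits the divisibility of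
  -- the sum. Below degree `p` the factor `i + 1` is a unit and can be dropped.
  have hterm (i : ℕ) (hi : i + 1 < p) : t ^ (p + (p - 1) * b) ∣ N.coeff (i + 1) * t ^ (i + 1) := by
    have h1 := pow_dvd_smul_of_pow_dvd_sum h.irreducible_s h.irreducible_t h.associated_s
      (fun _ => .refl _) _ _ (hsum ▸ hder.symm.dvd) ⟨i, by omega⟩
    have hu : IsUnit (algebraMap S T ((i : S) + 1)) := by
      have := (h.isUnit_cast i.succ_pos hi).map (algebraMap S T)
      rwa [Nat.cast_succ] at this
    rw [Algebra.smul_def, map_mul, mul_assoc, hu.dvd_mul_left, he] at h1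
    have h2 : p + (p - 1) * b = (p - 1) * (b + 1) + 1 := by
      obtain ⟨q, rfl⟩ := Nat.exists_eq_add_of_le hp.le
      rw [Nat.add_sub_cancel_left]; ring
    rw [h2, pow_succ, pow_succ, ← mul_assoc]
    exact mul_dvd_mul_right h1 t
  have hroot : N.eval t = 0 := by
    have := Lagrange.eval_nodal_at_node (v := fun τ : T ≃ₐ[S] T => τ t)
      (Finset.mem_univ (1 : T ≃ₐ[S] T))
    exact this
  rw [eval_eq_sum_range, hdeg, Finset.sum_range_succ, hlead, one_mul] at hroot
  obtain ⟨q, rfl⟩ := Nat.exists_eq_add_of_le' hp.le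
  rw [Finset.sum_range_succ', pow_zero, mul_one, hN, h.coeff_zero, ← hN] at hroot
  have : algebraMap S T s - t ^ (q + 1) = ∑ i ∈ Finset.range q, N.coeff (i + 1) * t ^ (i + 1) := by
    linear_combination -hroot
  rw [this]
  exact Finset.dvd_sum fun i hi => hterm i (by have := Finset.mem_range.1 hi; omega)

theorem pow_dvd_s_pow_sub_pow (q : ℕ) :
    t ^ (p * q + (p - 1) * b) ∣ algebraMap S T s ^ q - t ^ (p * q) := by
  obtain ⟨w, hw⟩ := h.pow_dvd_s_sub_pow
  have h1 : algebraMap S T s = t ^ p * (1 + t ^ ((p - 1) * b) * w) := by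
    rw [← sub_add_cancel (algebraMap S T s) (t ^ p), hw, pow_add]; ring
  have h2 : algebraMap S T s ^ q - t ^ (p * q) =
      t ^ (p * q) * ((1 + t ^ ((p - 1) * b) * w) ^ q - 1 ^ q) := by
    rw [h1, mul_pow, pow_mul]; ring
  rw [h2, pow_add]
  exact mul_dvd_mul_left _ (Dvd.dvd.trans ⟨w, by ring⟩ (sub_dvd_pow_sub_pow _ _ _))

end IsCyclicRamified

/-! ### Membership in the image by Lagrange interpolation -/

/-- The `T`-linear extension of `f : T → T` along `S[t] → T[X]`, with `X ^ l ↦ f (t ^ l)`. -/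
noncomputable def polyExtension (t : T) (f : Module.End S T) : T[X] →ₗ[T] T :=
  Polynomial.lsum fun l => LinearMap.toSpanSingleton T T (f (t ^ l))

theorem polyExtension_eq_sum_range (t : T) (f : Module.End S T) {P : T[X]} {n : ℕ}
    (hn : P.natDegree < n) :
    polyExtension t f P = ∑ l ∈ Finset.range n, P.coeff l * f (t ^ l) := by
  rw [polyExtension, Polynomial.lsum_apply]
  exact P.sum_over_range' (by simp) n hn

theorem polyExtension_X_pow (t : T) (f : Module.End S T) (l : ℕ) :
    polyExtension t f (X ^ l) = f (t ^ l) := by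
  simp [polyExtension, Polynomial.lsum_apply, X_pow_eq_monomial, sum_monomial_index]

theorem polyExtension_of_forall_apply [Fintype (T ≃ₐ[S] T)] (t : T) {f : Module.End S T}
    {y : (T ≃ₐ[S] T) → T} (hf : ∀ x, f x = ∑ ρ, y ρ * ρ x) (P : T[X]) :
    polyExtension t f P = ∑ ρ, y ρ * P.eval (ρ t) := by
  rw [polyExtension_eq_sum_range t f (Nat.lt_succ_self _)]
  simp only [hf, eval_eq_sum_range, Finset.mul_sum]
  rw [Finset.sum_comm]
  exact Finset.sum_congr rfl fun ρ _ => Finset.sum_congr rfl fun l _ => by rw [map_pow]; ring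

theorem polyExtension_sub (t : T) (f g : Module.End S T) (P : T[X]) :
    polyExtension t (f - g) P = polyExtension t f P - polyExtension t g P := by
  rw [polyExtension_eq_sum_range t _ (Nat.lt_succ_self _),
    polyExtension_eq_sum_range t _ (Nat.lt_succ_self _),
    polyExtension_eq_sum_range t _ (Nat.lt_succ_self _), ← Finset.sum_sub_distrib]
  exact Finset.sum_congr rfl fun l _ => by rw [LinearMap.sub_apply]; ring

namespace IsCyclicRamified

variable [Fintype (T ≃ₐ[S] T)] [DecidableEq (T ≃ₐ[S] T)] {s : S} {t : T} {p b : ℕ}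
  (h : IsCyclicRamified s t p b)

include h

/-- Isolates a single coefficient `y ρ`, since `conjNodal t ρ` vanishes at all other conjugates. -/
theorem polyExtension_conjNodal {f : Module.End S T}
    {y : (T ≃ₐ[S] T) → T} (hf : ∀ x, f x = ∑ ρ, y ρ * ρ x) (ρ : T ≃ₐ[S] T) :
    polyExtension t f (conjNodal t ρ) = y ρ * (conjNodal t ρ).eval (ρ t) := by
  rw [polyExtension_of_forall_apply t hf]
  refine Finset.sum_eq_single ρ (fun τ _ hτ => ?_) (by simp)
  rw [eval_conjNodal_of_ne t hτ, mul_zero]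

/-- An endomorphism is determined by its extension on the polynomials `conjNodal t ρ`. -/
theorem eq_zero_of_polyExtension_conjNodal_eq_zero [Module.Finite S T] {f : Module.End S T}
    (hf : ∀ ρ : T ≃ₐ[S] T, polyExtension t f (conjNodal t ρ) = 0) : f = 0 := by
  classical
  obtain ⟨B, hB⟩ := h.exists_basis
  refine B.ext fun i => ?_
  rw [LinearMap.zero_apply, hB]
  have hE (ρ : T ≃ₐ[S] T) : (conjNodal t ρ).eval (ρ t) ≠ 0 := fun h0 => by
    have := h.eval_conjNodal_self ρ
    rw [h0] at this
    exact pow_ne_zero _ h.irreducible_t.ne_zero ((associated_zero_iff_eq_zero _).1 this.symm)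
  -- Lagrange interpolation of `X ^ i` at the conjugates of `t`, multiplied by `D` to clear
  -- denominators; it is exact because `i < p`.
  set D := ∏ ρ : T ≃ₐ[S] T, (conjNodal t ρ).eval (ρ t) with hD
  have hD0 : D ≠ 0 := Finset.prod_ne_zero_iff.2 fun ρ _ => hE ρ
  set c : (T ≃ₐ[S] T) → T := fun ρ => (ρ t) ^ (i : ℕ) *
    ∏ τ ∈ Finset.univ.erase ρ, (conjNodal t τ).eval (τ t) with hc
  have key : C D * X ^ (i : ℕ) = ∑ ρ, C (c ρ) * conjNodal t ρ := by
    refine eq_of_degree_sub_lt_of_eval_finset_eq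
      (Finset.univ.image fun ρ : T ≃ₐ[S] T => ρ t) ?_ ?_
    · rw [Finset.card_image_of_injective _ h.injective_apply, Finset.card_univ, h.card_eq]
      refine (degree_sub_le _ _).trans_lt (max_lt ?_ ?_)
      · exact (degree_C_mul_X_pow_le _ _).trans_lt (by exact_mod_cast i.2)
      · refine (degree_sum_le _ _).trans_lt ((Finset.sup_lt_iff (by simp)).2 fun ρ _ => ?_)
        exact degree_le_natDegree.trans_lt (by
          exact_mod_cast (natDegree_C_mul_le _ _).trans_lt (h.natDegree_conjNodal_lt ρ))
    · intro x hx
      obtain ⟨ρ, -, rfl⟩ := Finset.mem_image.1 hx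
      simp only [eval_mul, eval_C, eval_pow, eval_X, eval_finsetSum]
      rw [Finset.sum_eq_single ρ (fun τ _ hτ => by rw [eval_conjNodal_of_ne t hτ.symm, mul_zero])
        (by simp), hc, hD, ← Finset.mul_prod_erase _ _ (Finset.mem_univ ρ)]
      ring
  have h1 := congrArg (polyExtension t f) key
  simp only [← smul_eq_C_mul, map_sum, map_smul, hf, polyExtension_X_pow, smul_zero,
    Finset.sum_const_zero] at h1
  exact (smul_eq_zero.1 h1).resolve_left hD0

/-- A congruence criterion for membership in the image of the Wedderburn map. -/
theorem mem_Xi_iff_pow_dvd [Module.Finite S T] {f : Module.End S T} :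
    f ∈ Xi S T ↔ ∀ ρ : T ≃ₐ[S] T, t ^ ((p - 1) * (b + 1)) ∣ polyExtension t f (conjNodal t ρ) := by
  constructor
  · rw [mem_Xi_iff]
    rintro ⟨y, hy⟩ ρ
    rw [h.polyExtension_conjNodal hy]
    exact (h.eval_conjNodal_self ρ).symm.dvd.mul_left _
  · intro hf
    choose y hy using fun ρ : T ≃ₐ[S] T => (h.eval_conjNodal_self ρ).dvd.trans (hf ρ)
    set g : Module.End S T := ∑ ρ, Algebra.lmul S T (y ρ) * ρ.toLinearMap with hg
    have hgy (x : T) : g x = ∑ ρ, y ρ * ρ x := by simp [hg]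
    have : f - g = 0 := h.eq_zero_of_polyExtension_conjNodal_eq_zero fun ρ => by
      rw [polyExtension_sub, h.polyExtension_conjNodal hgy, hy]; ring
    rw [sub_eq_zero.1 this]
    exact mem_Xi_iff.2 ⟨y, hgy⟩

omit [DecidableEq (T ≃ₐ[S] T)] in
/-- Endomorphisms raising the valuation by at least `(p - 1) b` lie in `Xi S T`. -/
theorem mem_Xi_of_pow_dvd [Module.Finite S T] {f : Module.End S T}
    (hf : ∀ l < p, t ^ (l + (p - 1) * b) ∣ f (t ^ l)) : f ∈ Xi S T := by
  classical
  rw [h.mem_Xi_iff_pow_dvd]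
  intro ρ
  rw [polyExtension_eq_sum_range t f (h.natDegree_conjNodal_lt ρ)]
  refine Finset.dvd_sum fun l hl => ?_
  have hl := Finset.mem_range.1 hl
  have h1 : (p - 1) * (b + 1) = (p - 1 - l) + (l + (p - 1) * b) := by
    rw [mul_add, mul_one]; omega
  rw [h1, pow_add]
  exact mul_dvd_mul (h.pow_dvd_coeff_conjNodal ρ l) (hf l hl)

omit [DecidableEq (T ≃ₐ[S] T)] in
/-- Endomorphisms approximating the derivation `t ^ (b + 1) d/dt` lie in `Xi S T`. -/
theorem mem_Xi_of_pow_dvd_sub [Module.Finite S T] {f : Module.End S T}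
    (hf : ∀ l < p, t ^ (l + (p - 1) * b) ∣ f (t ^ l) - l * t ^ (l + b)) : f ∈ Xi S T := by
  classical
  rw [h.mem_Xi_iff_pow_dvd]
  intro ρ
  have hp := h.prime.two_le
  -- The main term is the extension of `t ^ (b + 1) d/dt`. The derivative is evaluated at `t` for
  -- every `ρ`, where it is a sum of products of `p - 2` differences `t - τ t`.
  have h0 : polyExtension t f (conjNodal t ρ) = t ^ (b + 1) * (derivative (conjNodal t ρ)).eval t +
      ∑ l ∈ Finset.range p, (conjNodal t ρ).coeff l * (f (t ^ l) - l * t ^ (l + b)) := by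
    rw [polyExtension_eq_sum_range t f (h.natDegree_conjNodal_lt ρ), derivative_eval,
      Polynomial.sum_over_range' _ (by simp) p (h.natDegree_conjNodal_lt ρ), Finset.mul_sum,
      ← Finset.sum_add_distrib]
    refine Finset.sum_congr rfl fun l _ => ?_
    cases l with
    | zero => simp
    | succ l => rw [Nat.add_sub_cancel]; push_cast; ring
  rw [h0]
  refine dvd_add ?_ (Finset.dvd_sum fun l hl => ?_)
  · have h1 : (p - 1) * (b + 1) = (b + 1) + (p - 2) * (b + 1) := by
      obtain ⟨q, rfl⟩ := Nat.exists_eq_add_of_le hp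
      rw [Nat.add_sub_cancel_left, show 2 + q - 1 = q + 1 by omega]; ring
    rw [h1, pow_add]
    exact mul_dvd_mul_left _ (h.pow_dvd_eval_derivative_conjNodal ρ)
  · have hl := Finset.mem_range.1 hl
    have h1 : (p - 1) * (b + 1) = (p - 1 - l) + (l + (p - 1) * b) := by
      rw [mul_add, mul_one]; omega
    rw [h1, pow_add]
    exact mul_dvd_mul (h.pow_dvd_coeff_conjNodal ρ l) (hf l hl)

end IsCyclicRamified

end CyclicRamified

/-! ### The elements `a` and `c` -/

section CyclicRamified

set_option linter.unusedSectionVars false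

open Polynomial

variable {S T : Type*} [CommRing S] [IsDomain S] [IsDiscreteValuationRing S]
  [CommRing T] [IsDomain T] [IsDiscreteValuationRing T] [Algebra S T]

theorem epsilon_apply {t : T} {s : S} {p : ℕ}
    {B : Module.Basis (Fin p) S T} (hB : ∀ i, B i = t ^ (i : ℕ)) (i j : ℕ) {l : ℕ} (hl : l < p) :
    epsilon B s i j (t ^ l) =
      if i = l then algebraMap S T s ^ ((l + j) / p) * t ^ ((l + j) % p) else 0 := by
  have := B.constr_basis S (fun l : Fin p =>
    if i = (l : ℕ) then
      s ^ (((l : ℕ) + j) / p) • B ⟨((l : ℕ) + j) % p, Nat.mod_lt _ l.pos⟩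
    else 0) ⟨l, hl⟩
  rw [hB] at this
  refine this.trans ?_
  simp [hB, Algebra.smul_def]

theorem betaElt_apply {t : T} {s : S} {p : ℕ} {B : Module.Basis (Fin p) S T}
    (hB : ∀ i, B i = t ^ (i : ℕ)) (b : ℕ) {l : ℕ} (hl : l < p) :
    betaElt B s b (t ^ l) = l * (algebraMap S T s ^ ((l + b) / p) * t ^ ((l + b) % p)) := by
  have hdiv : b / p + (l + b % p) / p = (l + b) / p := by
    conv_rhs => rw [← Nat.mod_add_div b p, ← add_assoc, Nat.add_mul_div_left _ _ (by omega)]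
    ring
  rw [betaElt, LinearMap.smul_apply, LinearMap.sum_apply,
    Finset.sum_eq_single l (fun i _ hi => ?_) (fun h => absurd (Finset.mem_range.2 hl) h)]
  · rw [LinearMap.smul_apply, epsilon_apply hB _ _ hl, if_pos rfl, Nat.add_mod_mod, ← hdiv, pow_add,
      Algebra.smul_def, map_pow, nsmul_eq_mul]
    ring
  · rw [LinearMap.smul_apply, epsilon_apply hB _ _ hl, if_neg hi, smul_zero]

namespace IsCyclicRamified

variable [Fintype (T ≃ₐ[S] T)] {s : S} {t : T} {p b : ℕ}
  (h : IsCyclicRamified s t p b)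

include h

theorem div_lt : b / p + 1 ≤ b := by
  have := Nat.div_lt_self h.one_le h.prime.one_lt
  omega

/-- Explains the power of `s` in `a`: its value at `t ^ (b % p)` meets the bound of
`mem_Xi_of_pow_dvd` exactly. -/
theorem mul_sub_div : p * (b - b / p) = b % p + (p - 1) * b := by
  obtain ⟨q, rfl⟩ := Nat.exists_eq_add_of_le' h.prime.one_lt.le
  have := Nat.mod_add_div b (q + 1)
  rw [Nat.mul_sub, Nat.add_sub_cancel]
  have : (q + 1) * b = b + q * b := by ring
  omega

/-- The shift `p - b % p` completes `t ^ (b % p)` to a full `t ^ p`, which becomes `s`; hence all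
values of `a` lie in `S · 1`. -/
theorem alphaElt_apply {B : Module.Basis (Fin p) S T} (hB : ∀ i, B i = t ^ (i : ℕ)) {l : ℕ}
    (hl : l < p) :
    alphaElt B s b (t ^ l) = if b % p = l then algebraMap S T s ^ (b - b / p) else 0 := by
  have hb := h.div_lt
  rw [alphaElt, LinearMap.smul_apply, epsilon_apply hB _ _ hl]
  split_ifs with hbl
  · subst hbl
    rw [Nat.add_sub_cancel' hl.le, Nat.div_self h.prime.pos, Nat.mod_self, pow_zero, mul_one,
      Algebra.smul_def, map_pow, ← pow_add]
    congr 1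
    omega
  · exact smul_zero _

theorem associated_s_pow : Associated (algebraMap S T s ^ (b - b / p)) (t ^ (b % p + (p - 1) * b)) := by
  rw [← h.mul_sub_div, pow_mul]
  exact h.associated_s.pow_pow

theorem alphaElt_mem [Module.Finite S T] {B : Module.Basis (Fin p) S T}
    (hB : ∀ i, B i = t ^ (i : ℕ)) : alphaElt B s b ∈ Xi S T := by
  refine h.mem_Xi_of_pow_dvd fun l hl => ?_
  rw [h.alphaElt_apply hB hl]
  split_ifs with hbl
  · rw [← hbl]; exact h.associated_s_pow.symm.dvd
  · exact dvd_zero _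

theorem betaElt_mem [Module.Finite S T] {B : Module.Basis (Fin p) S T}
    (hB : ∀ i, B i = t ^ (i : ℕ)) : betaElt B s b ∈ Xi S T := by
  refine h.mem_Xi_of_pow_dvd_sub fun l hl => ?_
  rw [betaElt_apply hB _ hl]
  have h1 : (l : T) * (algebraMap S T s ^ ((l + b) / p) * t ^ ((l + b) % p)) - l * t ^ (l + b) =
      l * ((algebraMap S T s ^ ((l + b) / p) - t ^ (p * ((l + b) / p))) * t ^ ((l + b) % p)) := by
    nth_rw 3 [← Nat.div_add_mod (l + b) p]
    rw [pow_add]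
    ring
  rw [h1]
  refine Dvd.dvd.mul_left ?_ _
  refine (pow_dvd_pow t (?_ : _ ≤ (p * ((l + b) / p) + (p - 1) * b) + (l + b) % p)).trans ?_
  · have := Nat.div_add_mod (l + b) p
    omega
  · rw [pow_add]
    exact mul_dvd_mul_right (h.pow_dvd_s_pow_sub_pow _) _

theorem alphaElt_mul_betaElt {B : Module.Basis (Fin p) S T} (hB : ∀ i, B i = t ^ (i : ℕ)) :
    alphaElt B s b * betaElt B s b = 0 := by
  refine B.ext fun i => ?_
  rw [hB, Module.End.mul_apply, betaElt_apply hB _ i.2, ← map_pow, ← Algebra.smul_def,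
    ← nsmul_eq_mul, map_nsmul, map_smul, h.alphaElt_apply hB (Nat.mod_lt _ h.prime.pos)]
  rcases Nat.eq_zero_or_pos (i : ℕ) with hi | hi
  · simp [hi]
  · rw [if_neg, smul_zero, smul_zero, LinearMap.zero_apply]
    intro hmod
    have h1 : b ≡ i + b [MOD p] := hmod
    have h2 : (0 : ℕ) ≡ i [MOD p] := Nat.ModEq.add_right_cancel' b (by simpa using h1)
    have := Nat.le_of_dvd hi ((Nat.modEq_zero_iff_dvd).1 h2.symm)
    omega

theorem betaElt_one {B : Module.Basis (Fin p) S T} (hB : ∀ i, B i = t ^ (i : ℕ)) :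
    betaElt B s b 1 = 0 := by
  have := betaElt_apply (s := s) hB b h.prime.pos
  simpa using this

theorem betaElt_mul_alphaElt {B : Module.Basis (Fin p) S T} (hB : ∀ i, B i = t ^ (i : ℕ)) :
    betaElt B s b * alphaElt B s b = 0 := by
  refine B.ext fun i => ?_
  rw [hB, Module.End.mul_apply, h.alphaElt_apply hB i.2, LinearMap.zero_apply]
  split_ifs
  · rw [← map_pow, Algebra.algebraMap_eq_smul_one, map_smul, h.betaElt_one hB, smul_zero]
  · exact map_zero _

/-- Right multiplication by `alphaElt` only depends on the value at `1`. -/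
theorem mul_alphaElt {B : Module.Basis (Fin p) S T} (hB : ∀ i, B i = t ^ (i : ℕ))
    (f : Module.End S T) :
    f * alphaElt B s b = Algebra.lmul S T (f 1) * alphaElt B s b := by
  refine B.ext fun i => ?_
  rw [hB, Module.End.mul_apply, Module.End.mul_apply, h.alphaElt_apply hB i.2]
  split_ifs
  · rw [← map_pow, Algebra.algebraMap_eq_smul_one, map_smul, map_smul]
    simp
  · simp

theorem lmul_mul_alphaElt_eq_zero {B : Module.Basis (Fin p) S T} (hB : ∀ i, B i = t ^ (i : ℕ))
    {y : T} (hy : Algebra.lmul S T y * alphaElt B s b = 0) : y = 0 := by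
  have h1 := LinearMap.congr_fun hy (t ^ (b % p))
  rw [Module.End.mul_apply, h.alphaElt_apply hB (Nat.mod_lt _ h.prime.pos), if_pos rfl] at h1
  have h2 : algebraMap S T s ^ (b - b / p) ≠ 0 := fun h0 => by
    have := h.associated_s_pow
    rw [h0] at this
    exact pow_ne_zero _ h.irreducible_t.ne_zero ((associated_zero_iff_eq_zero _).1 this.symm)
  exact (mul_eq_zero.1 h1).resolve_right h2

/-! ### Annihilators and exactness -/

/-- The coefficients of `∏ (X - ρ(t))` over `ρ ≠ 1` have the smallest valuations possible. -/
theorem pow_dvd_coeff_conjNodal_sub [DecidableEq (T ≃ₐ[S] T)] (k : ℕ) (hk : k < p) :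
    t ^ p ∣ (conjNodal t (1 : T ≃ₐ[S] T)).coeff (p - 1 - k) - t ^ k := by
  induction k with
  | zero =>
    have h1 : (conjNodal t (1 : T ≃ₐ[S] T)).coeff (p - 1) = 1 := by
      have hm : (conjNodal t (1 : T ≃ₐ[S] T)).Monic := Lagrange.nodal_monic
      rwa [Monic.def, leadingCoeff, h.natDegree_conjNodal] at hm
    simp [h1]
  | succ k ih =>
    obtain ⟨e, he⟩ := h.exists_coeff
    set N := Lagrange.nodal Finset.univ fun τ : T ≃ₐ[S] T => τ t with hN
    -- This factorization gives a recursion for the coefficients. Its error terms are intermediate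
    -- coefficients of `N`, which lie in `S` and in the maximal ideal of `T`, hence are divisible by
    -- `s`, that is, by `t ^ p`.
    have hmul : N = (X - C t) * conjNodal t (1 : T ≃ₐ[S] T) := by
      rw [hN, Lagrange.nodal_eq_mul_nodal_erase (Finset.mem_univ (1 : T ≃ₐ[S] T)), conjNodal,
        AlgEquiv.one_apply]
    have hl : p - 1 - (k + 1) + 1 = p - 1 - k := by omega
    have hcoeff := congrArg (coeff · (p - 1 - (k + 1) + 1)) hmul
    simp only [sub_mul, coeff_sub, coeff_X_mul, coeff_C_mul] at hcoeff
    rw [hl] at hcoeff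
    have hdvd : t ^ (1 : ℕ) ∣ N.coeff (p - 1 - k) := by
      refine (pow_dvd_pow t ?_).trans
        (pow_dvd_coeff_nodal Finset.univ (fun τ _ => h.dvd_apply τ) _)
      rw [Finset.card_univ, h.card_eq]; omega
    have hNk : t ^ p ∣ N.coeff (p - 1 - k) := by
      rw [← he] at hdvd ⊢
      have hs : s ∣ e (p - 1 - k) := by
        refine h.irreducible_s.dvd_of_not_isUnit fun hu => ?_
        exact h.irreducible_t.not_isUnit
          (isUnit_of_dvd_unit (by simpa using hdvd) (hu.map (algebraMap S T)))
      exact h.associated_s.symm.dvd.trans (map_dvd _ hs)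
    have : (conjNodal t (1 : T ≃ₐ[S] T)).coeff (p - 1 - (k + 1)) - t ^ (k + 1) =
        N.coeff (p - 1 - k) + t * ((conjNodal t (1 : T ≃ₐ[S] T)).coeff (p - 1 - k) - t ^ k) := by
      rw [hcoeff]; ring
    rw [this]
    exact dvd_add hNk ((ih (by omega)).mul_left _)

theorem associated_coeff_conjNodal [DecidableEq (T ≃ₐ[S] T)] {l : ℕ} (hl : l < p) :
    Associated ((conjNodal t (1 : T ≃ₐ[S] T)).coeff l) (t ^ (p - 1 - l)) := by
  have h1 := h.pow_dvd_coeff_conjNodal_sub (p - 1 - l) (by omega)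
  rw [show p - 1 - (p - 1 - l) = l by omega] at h1
  refine associated_pow_of_dvd_of_not_dvd h.irreducible_t (h.pow_dvd_coeff_conjNodal 1 l) fun h2 => ?_
  have h3 := (dvd_sub_right h2).1 ((pow_dvd_pow t (by omega)).trans h1)
  have := h.irreducible_t.pow_dvd_pow_iff_le.1 h3
  omega

/-- The annihilator of `betaElt` is generated by `alphaElt`. -/
theorem exists_eq_lmul_mul_alphaElt [Module.Finite S T] {B : Module.Basis (Fin p) S T}
    (hB : ∀ i, B i = t ^ (i : ℕ)) {f : Module.End S T} (hf : f ∈ Xi S T)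
    (hfc : f * betaElt B s b = 0) : ∃ y : T, f = Algebra.lmul S T y * alphaElt B s b := by
  classical
  have hinj : algebraMap S T s ≠ 0 := fun h0 => by
    have := h.associated_s
    rw [h0] at this
    exact pow_ne_zero _ h.irreducible_t.ne_zero ((associated_zero_iff_eq_zero _).1 this.symm)
  have hker (l : ℕ) (hl : l < p) (hl0 : 0 < l) : f (t ^ ((l + b) % p)) = 0 := by
    have h1 := LinearMap.congr_fun hfc (t ^ l)
    rw [Module.End.mul_apply, betaElt_apply hB _ hl, ← map_pow, ← Algebra.smul_def,
      ← nsmul_eq_mul, map_nsmul, map_smul, nsmul_eq_mul, Algebra.smul_def, map_pow,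
      LinearMap.zero_apply] at h1
    have hu : (l : T) ≠ 0 := by
      have := (h.isUnit_cast hl0 hl).map (algebraMap S T)
      rw [map_natCast] at this
      exact this.ne_zero
    exact ((mul_eq_zero.1 h1).resolve_left hu |> mul_eq_zero.1).resolve_left (pow_ne_zero _ hinj)
  -- Take `l ≡ r - b` modulo `p`; it is nonzero precisely because `r ≠ b % p`.
  have hker' (r : ℕ) (hr : r < p) (hrb : r ≠ b % p) : f (t ^ r) = 0 := by
    have hbp := Nat.mod_lt b h.prime.pos
    have hb := Nat.mod_add_div b p
    rcases lt_or_gt_of_ne hrb with hlt | hlt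
    · have := hker (r + p - b % p) (by omega) (by omega)
      rwa [show r + p - b % p + b = r + p * (b / p + 1) by rw [mul_add]; omega,
        Nat.add_mul_mod_self_left, Nat.mod_eq_of_lt hr] at this
    · have := hker (r - b % p) (by omega) (by omega)
      rwa [show r - b % p + b = r + p * (b / p) by omega,
        Nat.add_mul_mod_self_left, Nat.mod_eq_of_lt hr] at this
  have hbp := Nat.mod_lt b h.prime.pos
  have h1 := h.mem_Xi_iff_pow_dvd.1 hf 1
  rw [polyExtension_eq_sum_range t f (h.natDegree_conjNodal_lt 1),
    Finset.sum_eq_single (b % p) (fun r hr hrb => by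
      rw [hker' r (Finset.mem_range.1 hr) hrb, mul_zero])
      (fun h0 => absurd (Finset.mem_range.2 hbp) h0)] at h1
  have h2 : (p - 1) * (b + 1) = (p - 1 - b % p) + (b % p + (p - 1) * b) := by
    rw [mul_add, mul_one]; omega
  have h3 : t ^ (p - 1 - b % p) * t ^ (b % p + (p - 1) * b) ∣
      t ^ (p - 1 - b % p) * f (t ^ (b % p)) := by
    rw [← pow_add, ← h2]
    exact h1.trans ((h.associated_coeff_conjNodal hbp).mul_right _).dvd
  obtain ⟨y, hy⟩ := h.associated_s_pow.dvd.trans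
    ((mul_dvd_mul_iff_left (pow_ne_zero _ h.irreducible_t.ne_zero)).1 h3)
  refine ⟨y, B.ext fun i => ?_⟩
  rw [hB, Module.End.mul_apply, h.alphaElt_apply hB i.2]
  split_ifs with hi
  · rw [← hi, hy]; simp [mul_comm]
  · rw [hker' i i.2 (Ne.symm hi), map_zero]

omit [IsDomain S] [IsDiscreteValuationRing S] [IsDomain T] [IsDiscreteValuationRing T] h in
/-- For a generator `σ`, the elements of `Xi S T` annihilating `1` are multiples of `σ - 1`. -/
theorem _root_.exists_eq_mul_sub_one {σ : T ≃ₐ[S] T}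
    (hσ : Subgroup.zpowers σ = ⊤) {f : Module.End S T} (hf : f ∈ Xi S T) (hf1 : f 1 = 0) :
    ∃ g ∈ Xi S T, f = g * (σ.toLinearMap - 1) := by
  obtain ⟨y, hy⟩ := mem_Xi_iff.1 hf
  have hpow (ρ : T ≃ₐ[S] T) : ∃ n : ℕ, σ ^ n = ρ := by
    have : ρ ∈ Subgroup.zpowers σ := hσ ▸ Subgroup.mem_top ρ
    exact mem_powers_iff_mem_zpowers.2 this
  choose n hn using hpow
  -- Since `f 1 = ∑ y ρ = 0`, one has `f = ∑ y ρ (ρ - 1)`; each `ρ - 1 = σ ^ n - 1` is a geometric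
  -- sum times `σ - 1`.
  refine ⟨∑ ρ, Algebra.lmul S T (y ρ) * ∑ i ∈ Finset.range (n ρ), σ.toLinearMap ^ i,
    sum_mem fun ρ _ => mul_mem (lmul_mem_Xi _)
      (sum_mem fun i _ => pow_mem (toLinearMap_mem_Xi σ) i), ?_⟩
  rw [Finset.sum_mul]
  simp only [mul_assoc, geom_sum_mul]
  ext x
  have hρ (ρ : T ≃ₐ[S] T) : σ.toLinearMap ^ n ρ = ρ.toLinearMap := by
    conv_rhs => rw [← hn ρ]
    exact (map_pow (AlgEquiv.toLinearMapHom S T) σ (n ρ)).symm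
  have h0 : ∑ ρ, y ρ = 0 := by simpa [hf1] using (hy 1).symm
  simp only [hρ]
  rw [hy]
  simp [mul_sub, ← Finset.sum_mul, h0]

/-- The elements of `Xi S T` annihilating `1` are multiples of `betaElt`. -/
theorem exists_eq_mul_betaElt [Module.Finite S T] {σ : T ≃ₐ[S] T}
    (hσ : Subgroup.zpowers σ = ⊤) {B : Module.Basis (Fin p) S T}
    (hB : ∀ i, B i = t ^ (i : ℕ)) {f : Module.End S T} (hf : f ∈ Xi S T) (hf1 : f 1 = 0) :
    ∃ g ∈ Xi S T, f = g * betaElt B s b := by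
  obtain ⟨z, hz, hcz⟩ := exists_eq_mul_sub_one hσ (h.betaElt_mem hB) (h.betaElt_one hB)
  obtain ⟨y, hy⟩ := mem_Xi_iff.1 hz
  -- Up to higher valuation, `z` acts as the scalar `∑ y ρ`. As `c t` and `σ t - t` both have
  -- valuation `b + 1`, this scalar is a unit.
  have hzx (x : T) : z x = (∑ ρ, y ρ) * x + ∑ ρ, y ρ * (ρ x - x) := by
    rw [hy, Finset.sum_mul, ← Finset.sum_add_distrib]
    exact Finset.sum_congr rfl fun ρ _ => by ring
  have hrest {n : ℕ} {x : T} (hx : t ^ n ∣ x) : t ^ (n + 1) ∣ ∑ ρ : T ≃ₐ[S] T, y ρ * (ρ x - x) :=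
    Finset.dvd_sum fun ρ _ => (h.pow_succ_dvd_apply_sub ρ hx).mul_left _
  have hct : Associated (betaElt B s b t) (t ^ (b + 1)) := by
    have h1 := betaElt_apply (s := s) hB b h.prime.one_lt
    rw [pow_one, Nat.cast_one, one_mul] at h1
    rw [h1]
    refine (h.associated_s.pow_pow.mul_right _).trans ?_
    rw [← pow_mul, ← pow_add, Nat.div_add_mod, add_comm 1 b]
    exact .refl _
  have hunit : IsUnit (∑ ρ, y ρ) := by
    by_contra hu
    have h1 : t ∣ ∑ ρ, y ρ := h.irreducible_t.dvd_of_not_isUnit hu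
    have h2 : t ^ (b + 1 + 1) ∣ betaElt B s b t := by
      rw [hcz]
      change _ ∣ z (σ t - t)
      rw [hzx]
      refine dvd_add ?_ (hrest (h.pow_dvd_sub σ))
      rw [pow_succ, mul_comm]
      exact mul_dvd_mul h1 (h.pow_dvd_sub σ)
    have := h.irreducible_t.pow_dvd_pow_iff_le.1 (h2.trans hct.dvd)
    omega
  have hzu : IsUnit z := by
    refine isUnit_of_associated_apply_pow h.irreducible_s h.irreducible_t h.associated_s
      h.finrank_eq fun i _ => ?_
    rw [hzx]
    refine associated_pow_of_dvd_of_not_dvd h.irreducible_t ?_ fun h2 => ?_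
    · exact dvd_add (dvd_mul_left _ _) ((pow_dvd_pow t i.le_succ).trans (hrest dvd_rfl))
    · have h3 := (dvd_add_left (hrest dvd_rfl)).1 h2
      rw [hunit.dvd_mul_left] at h3
      have := h.irreducible_t.pow_dvd_pow_iff_le.1 h3
      omega
  have : Module.Free S T := Module.Free.of_basis B
  obtain ⟨z', hz', hzz⟩ := exists_mul_eq_one_of_isUnit_of_mem (Xi S T) hz hzu
  obtain ⟨g, hg, rfl⟩ := exists_eq_mul_sub_one hσ hf hf1
  refine ⟨g * z', mul_mem hg hz', ?_⟩
  rw [hcz, mul_assoc, ← mul_assoc z', hzz, one_mul]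

end IsCyclicRamified

end CyclicRamified

/-! ### Passage from the field extension, and assembly -/

theorem isCyclicRamified_of_isPurelyRamified {S T K L : Type*}
    [CommRing S] [IsDomain S] [IsDiscreteValuationRing S]
    [CommRing T] [IsDomain T] [IsDiscreteValuationRing T]
    [Field K] [Field L]
    [Algebra S K] [IsFractionRing S K] [Algebra T L] [IsFractionRing T L]
    [Algebra S T] [Algebra K L] [Algebra S L] [IsScalarTower S K L] [IsScalarTower S T L]
    [Module.Finite S T] [IsGalois K L] [Fintype (T ≃ₐ[S] T)]
    (hram : IsPurelyRamified S T K L)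
    (p : ℕ) (hp : p.Prime) [CharP (ResidueField S) p]
    (hdeg : Module.finrank K L = p)
    (t : T) (ht : maximalIdeal T = Ideal.span {t})
    (s : S) (hs : algebraMap S K s = (-1) ^ (p + 1) * Algebra.norm K (algebraMap T L t))
    (σ : T ≃ₐ[S] T) (hσ : Subgroup.zpowers σ = ⊤)
    (b : ℕ) (hb : 1 ≤ b)
    (hbσ : IsDiscreteValuationRing.addVal T (σ t - t) = (b : ℕ∞) + 1) :
    IsCyclicRamified s t p b := by
  have hfd : FiniteDimensional K L := Module.finite_of_finrank_pos (hdeg ▸ hp.pos)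
  have hcl : IsIntegralClosure T S L := IsIntegralClosure.of_isIntegrallyClosed T S L
  have ht' : Irreducible t := (IsDiscreteValuationRing.irreducible_iff_uniformizer t).2 ht
  have hcard : Nat.card (T ≃ₐ[S] T) = p := by
    rw [← Nat.card_congr (galRestrict S K L T).toEquiv, IsGalois.card_aut_eq_finrank, hdeg]
  have hcard' : Fintype.card (T ≃ₐ[S] T) = p := by rw [← Nat.card_eq_fintype_card, hcard]
  have hnorm : algebraMap S T s = (-1) ^ (p + 1) * ∏ ρ : T ≃ₐ[S] T, ρ t := by
    apply IsFractionRing.injective T L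
    rw [← IsScalarTower.algebraMap_apply, IsScalarTower.algebraMap_apply S K L, hs, map_mul,
      Algebra.norm_eq_prod_automorphisms, map_mul, map_prod]
    simp only [map_pow, map_neg, map_one]
    congr 1
    refine Fintype.prod_equiv (galRestrict S K L T).toEquiv _ _ fun g => ?_
    exact (algebraMap_galRestrict_apply S g t).symm
  have hst : Associated (algebraMap S T s) (t ^ p) :=
    hcard' ▸ associated_of_norm_eq ht' hnorm
  have hs' : Irreducible s := by
    obtain ⟨π, hπ⟩ := IsDiscreteValuationRing.exists_irreducible S
    have hπt : Associated (algebraMap S T π) (t ^ p) := by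
      rw [IsPurelyRamified, hdeg, hπ.maximalIdeal_eq, ht, Ideal.map_span, Set.image_singleton,
        Ideal.span_singleton_pow] at hram
      exact Ideal.span_singleton_eq_span_singleton.1 hram
    have hs0 : s ≠ 0 := by
      rintro rfl
      rw [map_zero] at hst
      exact pow_ne_zero _ ht'.ne_zero ((associated_zero_iff_eq_zero _).1 hst.symm)
    obtain ⟨n, hn⟩ := IsDiscreteValuationRing.associated_pow_irreducible hs0 hπ
    have h1 := hst.symm.trans (associated_map_pow hπt hn)
    -- Both `s` and a uniformizer `π` of `S` have valuation `p` in `T`, so `s` is associated to `π`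
    -- itself.
    have h2 : p = p * n := le_antisymm (ht'.pow_dvd_pow_iff_le.1 h1.dvd)
      (ht'.pow_dvd_pow_iff_le.1 h1.symm.dvd)
    have h3 : n = 1 := Nat.eq_of_mul_eq_mul_left hp.pos (by rw [← h2, mul_one])
    rw [h3, pow_one] at hn
    exact hn.symm.irreducible hπ
  have hσt : Associated (σ t - t) (t ^ (b + 1)) := by
    rw [← IsDiscreteValuationRing.addVal_eq_iff_associated, hbσ, ht'.addVal_pow]
    simp
  exact
    { prime := hp
      irreducible_s := hs'
      irreducible_t := ht'
      finrank_eq := by rw [← hdeg]; exact (IsFractionRing.finrank_eq S K T L).symm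
      card_eq := hcard'
      isInvariant := Algebra.isInvariant_of_isGalois' S K L T
      norm_eq := hnorm
      cast_p_mem := by
        rw [← mem_nonunits_iff, ← IsLocalRing.mem_maximalIdeal, ← IsLocalRing.residue_eq_zero_iff,
          map_natCast]
        exact CharP.cast_eq_zero _ p
      one_le := hb
      associated_sub := fun ρ hρ =>
        associated_apply_sub_of_ne_one ht' (hcard.symm ▸ hp) hσ hσt hρ }

theorem mainTheorem7 {S T K L : Type*}
    [CommRing S] [IsDomain S] [IsDiscreteValuationRing S]
    [CommRing T] [IsDomain T] [IsDiscreteValuationRing T]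
    [Field K] [Field L]
    [Algebra S K] [IsFractionRing S K] [Algebra T L] [IsFractionRing T L]
    [Algebra S T] [Algebra K L] [Algebra S L] [IsScalarTower S K L] [IsScalarTower S T L]
    [Module.Finite S T] [IsGalois K L]
    (hram : IsPurelyRamified S T K L)
    (p : ℕ) (hp : p.Prime) (hp3 : 3 ≤ p) [CharP (ResidueField S) p]
    (hdeg : Module.finrank K L = p)
    (t : T) (ht : maximalIdeal T = Ideal.span {t})
    (s : S) (hs : algebraMap S K s = (-1) ^ (p + 1) * Algebra.norm K (algebraMap T L t))
    (σ : T ≃ₐ[S] T) (hσ : Subgroup.zpowers σ = ⊤)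
    (b : ℕ) (hb : 1 ≤ b)
    (hbσ : IsDiscreteValuationRing.addVal T (σ t - t) = (b : ℕ∞) + 1)
    (hbp : ((b - b / p : ℕ) : ℕ∞) ≤ IsDiscreteValuationRing.addVal S (p : S)) :
    Function.Injective (wedderburn S T) ∧
    ∃ B : Module.Basis (Fin p) S T, (∀ i : Fin p, B i = t ^ (i : ℕ)) ∧
    ∃ (hα : alphaElt B s b ∈ Xi S T) (hβ : betaElt B s b ∈ Xi S T),
      let α := oneTo (Xi S T) (⟨alphaElt B s b, hα⟩ : Xi S T)
      let β := oneTo (Xi S T) (⟨betaElt B s b, hβ⟩ : Xi S T)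
      let χ₀ := oneTo (Xi S T) (1 : T)
      ∃ (hαβ : α ≫ β = 0) (hβα : β ≫ α = 0),
        (periodicComplex α β hαβ hβα).Acyclic ∧
        Nonempty (T ≃ₗ[Xi S T] LinearMap.range α.hom) ∧
        Function.Surjective χ₀ ∧
        (∃ ι : ModuleCat.of (Xi S T) T ⟶ ModuleCat.of (Xi S T) (Xi S T),
          Function.Injective ι ∧ α = χ₀ ≫ ι) ∧
        (∀ n : ℕ, Projective ((truncatedComplex α β hαβ hβα).X n)) ∧
        ∃ hβχ : (truncatedComplex α β hαβ hβα).d 1 0 ≫ χ₀ = 0,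
          QuasiIso ((ChainComplex.toSingle₀Equiv (truncatedComplex α β hαβ hβα)
            (ModuleCat.of (Xi S T) T)).symm ⟨χ₀, hβχ⟩) := by
  have hfd : FiniteDimensional K L := Module.finite_of_finrank_pos (hdeg ▸ hp.pos)
  have hcl : IsIntegralClosure T S L := IsIntegralClosure.of_isIntegrallyClosed T S L
  let _ : Fintype (T ≃ₐ[S] T) := Fintype.ofEquiv _ (galRestrict S K L T).toEquiv
  have h := isCyclicRamified_of_isPurelyRamified hram p hp hdeg t ht s hs σ hσ b hb hbσ
  obtain ⟨B, hB⟩ := h.exists_basis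
  have hα := h.alphaElt_mem hB
  have hβ := h.betaElt_mem hB
  have hαβ := h.alphaElt_mul_betaElt hB
  have hβα := h.betaElt_mul_alphaElt hB
  refine ⟨wedderburn_injective, B, hB, hα, hβ, ?_⟩
  intro α β χ₀
  have hαβ' : α ≫ β = 0 := by
    refine ModuleCat.hom_ext (LinearMap.ext fun x => Subtype.ext ?_)
    change (x : Module.End S T) * alphaElt B s b * betaElt B s b = 0
    rw [mul_assoc, hαβ, mul_zero]
  have hβα' : β ≫ α = 0 := by
    refine ModuleCat.hom_ext (LinearMap.ext fun x => Subtype.ext ?_)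
    change (x : Module.End S T) * betaElt B s b * alphaElt B s b = 0
    rw [mul_assoc, hβα, mul_zero]
  have hsurj : Function.Surjective χ₀ := fun y =>
    ⟨⟨_, lmul_mem_Xi y⟩, mul_one y⟩
  let ι : T →ₗ[Xi S T] Xi S T :=
    { toFun := fun y => ⟨_, mul_mem (lmul_mem_Xi y) hα⟩
      map_add' := fun y z => Subtype.ext (by
        change Algebra.lmul S T (y + z) * _ = Algebra.lmul S T y * _ + Algebra.lmul S T z * _
        rw [map_add, add_mul])
      map_smul' := fun ξ y => Subtype.ext (by
        change Algebra.lmul S T ((ξ : Module.End S T) y) * _ =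
          (ξ : Module.End S T) * (Algebra.lmul S T y * _)
        -- Linearity holds because `ξ y a` sees only the value of `ξ y` at `1`, which is `ξ(y)`.
        rw [← mul_assoc, h.mul_alphaElt hB (_ * _), Module.End.mul_apply]
        simp) }
  have hι : Function.Injective ι := by
    intro y z hyz
    refine sub_eq_zero.1 (h.lmul_mul_alphaElt_eq_zero hB ?_)
    rw [map_sub, sub_mul, sub_eq_zero]
    exact congrArg Subtype.val hyz
  have hαι : α = χ₀ ≫ ModuleCat.ofHom ι := by
    refine ModuleCat.hom_ext (LinearMap.ext fun x => Subtype.ext ?_)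
    exact h.mul_alphaElt hB x
  have hex₁ : Function.Exact α β := by
    intro x
    constructor
    · intro hx
      obtain ⟨y, hy⟩ := h.exists_eq_lmul_mul_alphaElt hB x.2 (congrArg Subtype.val hx)
      exact ⟨⟨_, lmul_mem_Xi y⟩, Subtype.ext hy.symm⟩
    · rintro ⟨y, rfl⟩
      exact ConcreteCategory.congr_hom hαβ' y
  have hex₃ : Function.Exact β χ₀ := by
    intro x
    constructor
    · intro hx
      obtain ⟨g, hg, hxg⟩ := h.exists_eq_mul_betaElt hσ hB x.2 hx
      exact ⟨⟨g, hg⟩, Subtype.ext hxg.symm⟩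
    · rintro ⟨y, rfl⟩
      change (y : Module.End S T) (betaElt B s b 1) = 0
      rw [h.betaElt_one hB, map_zero]
  have hex₂ : Function.Exact β α := by
    intro x
    rw [← hex₃ x, hαι]
    exact map_eq_zero_iff ι hι
  refine ⟨hαβ', hβα', periodicComplex_acyclic hex₁ hex₂, ?_, hsurj,
    ⟨ModuleCat.ofHom ι, hι, hαι⟩, fun n => ?_, ?_, ?_⟩
  · have hrange : LinearMap.range α.hom = LinearMap.range ι := by
      rw [hαι]
      exact LinearMap.range_comp_of_range_eq_top _ (LinearMap.range_eq_top.2 hsurj)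
    rw [hrange]
    exact ⟨LinearEquiv.ofInjective ι hι⟩
  · exact (IsProjective.iff_projective (Xi S T)).1 inferInstance
  · rw [truncatedComplex_d_succ, if_neg (by decide)]
    refine ModuleCat.hom_ext (LinearMap.ext fun x => ?_)
    exact hex₃.apply_apply_eq_zero x
  · exact quasiIso_truncatedComplex _ hex₁ hex₂ hex₃ hsurj
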